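/- Let $M$ be a positive integer (the base), let $\mathcal{A}$ be a non-empty proper subset of $\{0,1,\dots,M-1\}$ (the alphabet), and let $\overline{\mathcal{A}}=\{0,1,\dots,|\mathcal{A}|-1\}$ be the canonical alphabet of the same size. For $n\in\{0,1,2,\dots\}$, $L>0$ and an alphabet $\mathcal{B}$ put $$C_n(L,M,\mathcal{B})=\bigcup_{m}\Big[\tfrac{L}{M^n}m,\ \tfrac{L}{M^n}(m+1)\Big],$$ where $m$ runs over all integers of the form $m=\sum_{j=0}^{n-1}b_jM^j$ with $b_0,\dots,b_{n-1}\in\mathcal{B}$, and for $R>0$ let $$\mathcal{C}_n(R,M,\mathcal{B})=\{(\omega,t)\in\mathbb{R}^2:\ \omega^2+t^2\in C_n(R^2,M,\mathcal{B})\}$$ be the spherically symmetric $n$-iterate Cantor set. Let $\phi(x)=2^{1/4}e^{-\pi x^2}$ and $V_\phi f(\omega,t)=\int_{\mathbb{R}}f(x)\overline{\phi(x-t)}e^{-2\pi i\omega x}\,dx$. For a bounded Borel set $\mathcal{E}\subseteq\mathbb{R}^2$, Daubechies' localization operator $P_{\mathcal{E}}:L^2(\mathbb{R})\to L^2(\mathbb{R})$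 is the unique bounded operator with $\langle P_{\mathcal{E}}f,g\rangle=\int_{\mathcal{E}}V_\phi f\,\overline{V_\phi g}$ for all $f,g\in L^2(\mathbb{R})$. Finally put $$\lambda_0(\mathcal{C}_n(R,M,\mathcal{B}))=\int_{C_n(\pi R^2,M,\mathcal{B})}e^{-r}\,dr .$$ Theorem. For all such $M$ and $\mathcal{A}$, every $R>0$ and every $n=0,1,2,\dots$, $$\|P_{\mathcal{C}_n(R,M,\mathcal{A})}\|_{\mathrm{op}}\le 2\,\lambda_0(\mathcal{C}_n(R,M,\overline{\mathcal{A}})).$$ Further, for the canonical alphabet, $$\|P_{\mathcal{C}_n(R,M,\overline{\mathcal{A}})}\|_{\mathrm{op}}=\lambda_0(\mathcal{C}_n(R,M,\overline{\mathcal{A}})),$$ and $\lambda_0(\mathcal{C}_n(R,M,\overline{\mathcal{A}}))$ is the largest eigenvalue of $P_{\mathcal{C}_n(R,M,\overline{\mathcal{A}})}$, with the Gaussian $\phi$ as an eigenfunction: $P_{\mathcal{C}_n(R,M,\overline{\mathcal{A}})}\phi=\lambda_0(\mathcal{C}_n(R,M,\overline{\mathcal{A}}))\,\phi$. -/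

import Mathlib

open MeasureTheory
open scoped ComplexConjugate

namespace DaubechiesCantor

/-! ### Short-time Fourier transform and localization operators -/

/-- The complex Hilbert space `L²(ℝ)`. -/
abbrev L2R : Type := Lp ℂ 2 (volume : Measure ℝ)

/-- The short-time Fourier transform of `f` with window `φ` at the point `z = (ω, t)`,
`V_φ f (ω, t) = ∫ f(x) conj(φ(x - t)) e^{-2πiωx} dx`. -/
noncomputable def stft (φ f : ℝ → ℂ) (z : ℝ × ℝ) : ℂ :=
  ∫ x : ℝ, f x * conj (φ (x - z.2)) * Complex.exp (-(2 * Real.pi * z.1 * x : ℝ) * Complex.I)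

/-- `P` is the localization operator with weight `F` and window `φ`, in the weak sense:
`⟨P f, g⟩ = ⟨F · V_φ f, V_φ g⟩_{L²(ℝ²)}` for all `f, g ∈ L²(ℝ)`.
(Mathlib's `inner ℂ g h` is linear in `h`, hence is the usual `⟨h, g⟩`.) -/
def IsLocalizationOperator (F : ℝ × ℝ → ℝ) (φ : ℝ → ℂ) (P : L2R →L[ℂ] L2R) : Prop :=
  ∀ f g : L2R, inner ℂ g (P f) = ∫ z : ℝ × ℝ, (F z : ℂ) * stft φ f z * conj (stft φ g z)

section Existence

variable {φ : ℝ → ℂ}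

lemma norm_phase (a : ℝ) : ‖Complex.exp (-(a : ℝ) * Complex.I)‖ = 1 := by
  have h := Complex.norm_exp_ofReal_mul_I (-a)
  simpa using h

lemma memLp_translate (hφ : MemLp φ 2 volume) (t : ℝ) :
    MemLp (fun x => φ (x - t)) 2 volume :=
  hφ.comp_measurePreserving (measurePreserving_sub_right volume t)

/-- The time-frequency shift of the window, as a function. -/
noncomputable def shift (φ : ℝ → ℂ) (z : ℝ × ℝ) (x : ℝ) : ℂ :=
  φ (x - z.2) * Complex.exp ((2 * Real.pi * z.1 * x : ℝ) * Complex.I)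

lemma memLp_shift (hφ : MemLp φ 2 volume) (z : ℝ × ℝ) :
    MemLp (shift φ z) 2 volume := by
  have h := memLp_translate hφ z.2
  refine h.of_le ?_ ?_
  · refine h.1.mul (Continuous.aestronglyMeasurable ?_)
    fun_prop
  · refine Filter.Eventually.of_forall fun x => ?_
    rw [shift, norm_mul, Complex.norm_exp_ofReal_mul_I, mul_one]

lemma norm_toLp_shift (hφ : MemLp φ 2 volume) (z : ℝ × ℝ) :
    ‖(memLp_shift hφ z).toLp‖ = ‖hφ.toLp‖ := by
  rw [Lp.norm_toLp, Lp.norm_toLp]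
  congr 1
  rw [← eLpNorm_comp_measurePreserving hφ.1 (measurePreserving_sub_right volume z.2)]
  refine eLpNorm_congr_norm_ae (Filter.Eventually.of_forall fun x => ?_)
  rw [shift, norm_mul, Complex.norm_exp_ofReal_mul_I, mul_one]
  rfl

lemma stft_eq_inner (hφ : MemLp φ 2 volume) (f : L2R) (z : ℝ × ℝ) :
    stft φ f z = inner ℂ (memLp_shift hφ z).toLp f := by
  rw [L2.inner_def, stft]
  refine integral_congr_ae ?_
  filter_upwards [(memLp_shift hφ z).coeFn_toLp] with x hx
  rw [hx, RCLike.inner_apply, shift, map_mul, ← Complex.exp_conj, map_mul, Complex.conj_ofReal,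
    Complex.conj_I]
  ring_nf

lemma norm_stft_le (hφ : MemLp φ 2 volume) (f : L2R) (z : ℝ × ℝ) :
    ‖stft φ f z‖ ≤ ‖hφ.toLp‖ * ‖f‖ := by
  rw [stft_eq_inner hφ, ← norm_toLp_shift hφ z]
  exact norm_inner_le_norm _ _

lemma stft_add (hφ : MemLp φ 2 volume) (f g : L2R) (z : ℝ × ℝ) :
    stft φ (f + g : L2R) z = stft φ f z + stft φ g z := by
  simp only [stft_eq_inner hφ, inner_add_right]

lemma stft_smul (hφ : MemLp φ 2 volume) (c : ℂ) (f : L2R) (z : ℝ × ℝ) :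
    stft φ (c • f : L2R) z = c * stft φ f z := by
  simp only [stft_eq_inner hφ, inner_smul_right]

lemma stronglyMeasurable_stft (hφ : MemLp φ 2 volume) (f : L2R) :
    StronglyMeasurable (stft φ f) := by
  have key : stft φ f = stft (hφ.1.mk φ) f := by
    funext z
    refine integral_congr_ae ?_
    have h := (measurePreserving_sub_right volume z.2).quasiMeasurePreserving.ae_eq_comp
      hφ.1.ae_eq_mk
    filter_upwards [h] with x hx
    have hx' : φ (x - z.2) = hφ.1.mk φ (x - z.2) := hx
    rw [hx']
  rw [key]
  have hm : StronglyMeasurable (hφ.1.mk φ) := hφ.1.stronglyMeasurable_mk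
  have hf : StronglyMeasurable (f : ℝ → ℂ) := Lp.stronglyMeasurable f
  have h1 : StronglyMeasurable fun p : (ℝ × ℝ) × ℝ => f p.2 :=
    hf.comp_measurable measurable_snd
  have h2 : StronglyMeasurable fun p : (ℝ × ℝ) × ℝ => conj (hφ.1.mk φ (p.2 - p.1.2)) :=
    Complex.continuous_conj.comp_stronglyMeasurable (hm.comp_measurable (by fun_prop))
  have h3 : StronglyMeasurable fun p : (ℝ × ℝ) × ℝ =>
      Complex.exp (-(2 * Real.pi * p.1.1 * p.2 : ℝ) * Complex.I) :=
    Continuous.stronglyMeasurable (by fun_prop)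
  exact StronglyMeasurable.integral_prod_right
    (f := fun (z : ℝ × ℝ) (x : ℝ) => f x * conj (hφ.1.mk φ (x - z.2)) *
      Complex.exp (-(2 * Real.pi * z.1 * x : ℝ) * Complex.I)) ((h1.mul h2).mul h3)

variable {F : ℝ × ℝ → ℝ}

lemma norm_integrand_le (hφ : MemLp φ 2 volume) (f g : L2R) (z : ℝ × ℝ) :
    ‖(F z : ℂ) * stft φ f z * conj (stft φ g z)‖
      ≤ ‖F z‖ * (‖hφ.toLp‖ * ‖f‖ * (‖hφ.toLp‖ * ‖g‖)) := by
  rw [norm_mul, norm_mul, RCLike.norm_conj, Complex.norm_real, mul_assoc]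
  gcongr
  · exact norm_stft_le hφ f z
  · exact norm_stft_le hφ g z

lemma integrable_integrand (hF : Integrable F volume) (hφ : MemLp φ 2 volume) (f g : L2R) :
    Integrable (fun z => (F z : ℂ) * stft φ f z * conj (stft φ g z)) volume := by
  refine (hF.norm.mul_const (‖hφ.toLp‖ * ‖f‖ * (‖hφ.toLp‖ * ‖g‖))).mono' ?_
    (Filter.Eventually.of_forall fun z => norm_integrand_le hφ f g z)
  refine (AEStronglyMeasurable.mul ?_ (stronglyMeasurable_stft hφ f).aestronglyMeasurable).mul ?_
  · exact Complex.continuous_ofReal.comp_aestronglyMeasurable hF.1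
  · exact (Complex.continuous_conj.comp_stronglyMeasurable
      (stronglyMeasurable_stft hφ g)).aestronglyMeasurable

/-- For an integrable weight and a square-integrable window, the weak definition determines
exactly one bounded operator. -/
theorem existsUnique_isLocalizationOperator (hF : Integrable F volume)
    (hφ : MemLp φ 2 volume) : ∃! P : L2R →L[ℂ] L2R, IsLocalizationOperator F φ P := by
  let B₀ : L2R →ₗ⋆[ℂ] L2R →ₗ[ℂ] ℂ := LinearMap.mk₂'ₛₗ (starRingEnd ℂ) (RingHom.id ℂ)
    (fun g f => ∫ z : ℝ × ℝ, (F z : ℂ) * stft φ f z * conj (stft φ g z))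
    (by
      intro g₁ g₂ f
      rw [← integral_add (integrable_integrand hF hφ f g₁) (integrable_integrand hF hφ f g₂)]
      refine integral_congr_ae (Filter.Eventually.of_forall fun z => ?_)
      simp only [stft_add hφ, map_add]
      ring)
    (by
      intro c g f
      rw [smul_eq_mul, ← integral_const_mul]
      refine integral_congr_ae (Filter.Eventually.of_forall fun z => ?_)
      simp only [stft_smul hφ, map_mul]
      ring)
    (by
      intro g f₁ f₂
      rw [← integral_add (integrable_integrand hF hφ f₁ g) (integrable_integrand hF hφ f₂ g)]
      refine integral_congr_ae (Filter.Eventually.of_forall fun z => ?_)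
      simp only [stft_add hφ]
      ring)
    (by
      intro c g f
      rw [RingHom.id_apply, smul_eq_mul, ← integral_const_mul]
      refine integral_congr_ae (Filter.Eventually.of_forall fun z => ?_)
      simp only [stft_smul hφ]
      ring)
  let B : L2R →L⋆[ℂ] L2R →L[ℂ] ℂ := B₀.mkContinuous₂
    ((∫ z, ‖F z‖) * (‖hφ.toLp‖ * ‖hφ.toLp‖)) (by
      intro g f
      change ‖∫ z : ℝ × ℝ, (F z : ℂ) * stft φ f z * conj (stft φ g z)‖ ≤ _
      refine (norm_integral_le_of_norm_le (hF.norm.mul_const _)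
        (Filter.Eventually.of_forall fun z => norm_integrand_le hφ f g z)).trans (le_of_eq ?_)
      rw [integral_mul_const]
      ring)
  have hB : ∀ g f, B g f = ∫ z : ℝ × ℝ, (F z : ℂ) * stft φ f z * conj (stft φ g z) :=
    fun g f => rfl
  refine ⟨ContinuousLinearMap.adjoint (InnerProductSpace.continuousLinearMapOfBilin B), ?_, ?_⟩
  · intro f g
    rw [ContinuousLinearMap.adjoint_inner_right,
      InnerProductSpace.continuousLinearMapOfBilin_apply, hB]
  · intro Q hQ
    ext1 f
    refine ext_inner_left ℂ fun g => ?_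
    rw [hQ f g, ContinuousLinearMap.adjoint_inner_right,
      InnerProductSpace.continuousLinearMapOfBilin_apply, hB]

end Existence

/-- Daubechies' localization operator `P_{F,φ}` on `L²(ℝ)`: the unique bounded operator with
`⟨P_{F,φ} f, g⟩ = ⟨F · V_φ f, V_φ g⟩` for all `f, g`. -/
noncomputable def localizationOperator (F : ℝ × ℝ → ℝ) (φ : ℝ → ℂ) (hF : Integrable F volume)
    (hφ : MemLp φ 2 volume) : L2R →L[ℂ] L2R :=
  (existsUnique_isLocalizationOperator hF hφ).choose

theorem localizationOperator_spec (F : ℝ × ℝ → ℝ) (φ : ℝ → ℂ) (hF : Integrable F volume)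
    (hφ : MemLp φ 2 volume) : IsLocalizationOperator F φ (localizationOperator F φ hF hφ) :=
  (existsUnique_isLocalizationOperator hF hφ).choose_spec.1

/-- The normalized Gaussian `φ(x) = 2^{1/4} e^{-π x²}`. -/
noncomputable def gaussian (x : ℝ) : ℂ :=
  (((2 : ℝ) ^ (1 / 4 : ℝ) * Real.exp (-Real.pi * x ^ 2) : ℝ) : ℂ)

lemma memLp_gaussian : MemLp gaussian 2 volume := by
  have hc : Continuous gaussian := by
    unfold gaussian
    fun_prop
  rw [memLp_two_iff_integrable_sq_norm hc.aestronglyMeasurable]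
  have h := (integrable_exp_neg_mul_sq (b := 2 * Real.pi) (by positivity)).const_mul
    (((2 : ℝ) ^ (1 / 4 : ℝ)) ^ 2)
  refine h.congr (Filter.Eventually.of_forall fun x => ?_)
  simp only [gaussian, Complex.norm_real, Real.norm_eq_abs, sq_abs, mul_pow]
  rw [← Real.exp_nat_mul]
  congr 2
  push_cast
  ring

/-- The Gaussian as an element of `L²(ℝ)`. -/
noncomputable def gaussianL2 : L2R := memLp_gaussian.toLp

/-! ### Cantor sets -/

/-- The canonical alphabet `{0, 1, …, |A| - 1}` of the same size as `A`. -/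
def canonicalAlphabet (A : Finset ℕ) : Finset ℕ := Finset.range A.card

/-- The `n`-iterate discrete Cantor set `{∑_{j<n} a_j M^j : a_j ∈ A}`. -/
def discreteCantor (n M : ℕ) (A : Finset ℕ) : Set ℕ :=
  {m | ∃ a : Fin n → ℕ, (∀ j, a j ∈ A) ∧ m = ∑ j, a j * M ^ (j : ℕ)}

/-- The `n`-iterate Cantor set based in `[0, L]`, the union of the intervals
`[L M⁻ⁿ m, L M⁻ⁿ m + L M⁻ⁿ]` with `m` in the discrete Cantor set. -/
def intervalCantor (n : ℕ) (L : ℝ) (M : ℕ) (A : Finset ℕ) : Set ℝ :=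
  ⋃ m ∈ discreteCantor n M A,
    Set.Icc (L / (M : ℝ) ^ n * (m : ℝ)) (L / (M : ℝ) ^ n * (m : ℝ) + L / (M : ℝ) ^ n)

/-- The spherically symmetric `n`-iterate Cantor set in the disk of radius `R`. -/
def sphericalCantor (n : ℕ) (R : ℝ) (M : ℕ) (A : Finset ℕ) : Set (ℝ × ℝ) :=
  {z | z.1 ^ 2 + z.2 ^ 2 ∈ intervalCantor n (R ^ 2) M A}

lemma finite_discreteCantor (n M : ℕ) (A : Finset ℕ) : (discreteCantor n M A).Finite := by
  have h : (Set.range fun a : Fin n → A => ∑ j, (a j : ℕ) * M ^ (j : ℕ)).Finite :=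
    Set.finite_range _
  refine h.subset ?_
  rintro m ⟨a, ha, rfl⟩
  exact ⟨fun j => ⟨a j, ha j⟩, rfl⟩

lemma isCompact_intervalCantor (n : ℕ) (L : ℝ) (M : ℕ) (A : Finset ℕ) :
    IsCompact (intervalCantor n L M A) :=
  (finite_discreteCantor n M A).isCompact_biUnion fun _ _ => isCompact_Icc

lemma isCompact_sphericalCantor (n : ℕ) (R : ℝ) (M : ℕ) (A : Finset ℕ) :
    IsCompact (sphericalCantor n R M A) := by
  have hK := isCompact_intervalCantor n (R ^ 2) M A
  refine Metric.isCompact_of_isClosed_isBounded ?_ ?_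
  · exact hK.isClosed.preimage (f := fun z : ℝ × ℝ => z.1 ^ 2 + z.2 ^ 2) (by fun_prop)
  · obtain ⟨C, hC⟩ := hK.bddAbove
    refine (Metric.isBounded_Icc ((-(1 + |C|), -(1 + |C|)) : ℝ × ℝ) (1 + |C|, 1 + |C|)).subset ?_
    intro z hz
    have h : z.1 ^ 2 + z.2 ^ 2 ≤ C := hC hz
    have hle := le_abs_self C
    have h0 := abs_nonneg C
    have h1 : |z.1| ≤ 1 + |C| := abs_le_of_sq_le_sq (by nlinarith [sq_nonneg z.2]) (by linarith)
    have h2 : |z.2| ≤ 1 + |C| := abs_le_of_sq_le_sq (by nlinarith [sq_nonneg z.1]) (by linarith)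
    exact ⟨⟨(abs_le.1 h1).1, (abs_le.1 h2).1⟩, ⟨(abs_le.1 h1).2, (abs_le.1 h2).2⟩⟩

/-- The indicator function of the spherically symmetric Cantor set. -/
noncomputable def cantorWeight (n : ℕ) (R : ℝ) (M : ℕ) (A : Finset ℕ) : ℝ × ℝ → ℝ :=
  (sphericalCantor n R M A).indicator fun _ => 1

lemma integrable_cantorWeight (n : ℕ) (R : ℝ) (M : ℕ) (A : Finset ℕ) :
    Integrable (cantorWeight n R M A) volume := by
  have h := isCompact_sphericalCantor n R M A
  refine (integrable_indicator_iff h.measurableSet).2 ?_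
  exact integrableOn_const h.measure_lt_top.ne

/-- Daubechies' operator with Gaussian window, localizing onto the spherically symmetric
`n`-iterate Cantor set of radius `R`, base `M` and alphabet `A`. -/
noncomputable def cantorOperator (n : ℕ) (R : ℝ) (M : ℕ) (A : Finset ℕ) : L2R →L[ℂ] L2R :=
  localizationOperator (cantorWeight n R M A) gaussian (integrable_cantorWeight n R M A)
    memLp_gaussian

/-- The numbers `λ_k = ∫ (r^k / k!) e^{-r} dr`, integrated over the `n`-iterate Cantor set
based in `[0, π R²]`. -/
noncomputable def cantorEigenvalue (k n : ℕ) (R : ℝ) (M : ℕ) (A : Finset ℕ) : ℝ :=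
  ∫ r in intervalCantor n (Real.pi * R ^ 2) M A, r ^ k / (k.factorial : ℝ) * Real.exp (-r)

end DaubechiesCantor

namespace DaubechiesCantor

/-! ### Generating functions of discrete Cantor sets -/

/-! On a radial set the functions `fockMonomial k` are pairwise orthogonal, and their squared norms,
multiplied by π^k / k!, are the numbers λ_k(A) = `cantorEigenvalue k`. The operator norm is
therefore at most any common bound of the λ_k. This is proved without the completeness of the
Hermite functions: the Gaussian reproducing kernel is expanded in monomials
(`hasSum_inner_coherentState`) and Bessel's inequality is applied in L² of the set
(`norm_le_of_orthogonal_fockMonomial`).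

It remains to show λ_k(A) ≤ λ_0(canonical alphabet) for every k (`cantorEigenvalue_le`). Let δ be
the cell length, x = e^{-δ}, and q_i the integral of r^k e^{-r} / k! over the i-th cell. Since r^k
is nondecreasing, q_{i+1} ≥ x q_i, so q is a nonnegative combination of the truncated geometric
sequences x^{i-m}, i ≥ m, with coefficients of total at most 1 - x. This reduces the bound to one on
tails of the generating function of the discrete Cantor set (`sum_le_of_tail_le`). Each tail,
shifted back to the origin, is at most the full generating function for the canonical alphabet
(`sum_tail_cantorFinset_le`): subtracting m shifts the lowest digits cyclically, and |A| distinct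
exponents give the largest sum when they are 0, ..., |A| - 1. The full generating function times 1 -
x is exactly λ_0.

For the canonical alphabet the bound is attained at the Gaussian, whose quadratic form equals λ_0,
and equality in Cauchy–Schwarz makes it an eigenvector. -/

/-- The `n`-iterate discrete Cantor set as a finite set, built by adding lowest digits. -/
def cantorFinset (M : ℕ) (A : Finset ℕ) : ℕ → Finset ℕ
  | 0 => {0}
  | n + 1 => (A ×ˢ cantorFinset M A n).image fun p => p.1 + M * p.2

lemma coe_cantorFinset (M : ℕ) (A : Finset ℕ) (n : ℕ) :
    (cantorFinset M A n : Set ℕ) = discreteCantor n M A := by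
  induction n with
  | zero =>
    ext m
    simp [cantorFinset, discreteCantor]
  | succ n ih =>
    ext m
    have ih' : ∀ d, d ∈ cantorFinset M A n ↔ d ∈ discreteCantor n M A := fun d => by
      rw [← ih, Finset.mem_coe]
    simp only [cantorFinset, Finset.coe_image, Set.mem_image, Finset.mem_coe, Finset.mem_product,
      Prod.exists, ih', discreteCantor, Set.mem_ofPred_eq]
    constructor
    · rintro ⟨a, _, ⟨ha, b, hb, rfl⟩, rfl⟩
      refine ⟨Fin.cons a b, fun j => ?_, ?_⟩
      · refine Fin.cases ?_ (fun i => ?_) j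
        · simpa using ha
        · simpa using hb i
      · rw [Fin.sum_univ_succ, Finset.mul_sum]
        simp only [Fin.cons_zero, Fin.cons_succ, Fin.val_zero, Fin.val_succ, pow_zero, mul_one]
        congr 1
        exact Finset.sum_congr rfl fun i _ => by ring
    · rintro ⟨b, hb, rfl⟩
      refine ⟨b 0, _, ⟨hb 0, fun i => b i.succ, fun i => hb _, rfl⟩, ?_⟩
      rw [Fin.sum_univ_succ, Finset.mul_sum]
      simp only [Fin.val_zero, Fin.val_succ, pow_zero, mul_one]
      congr 1
      exact Finset.sum_congr rfl fun i _ => by ring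

/-- Digits below M make the lowest digit and the remaining part unique, so the image defining the
next iterate has no collisions. -/
lemma sum_cantorFinset_succ {M : ℕ} {A : Finset ℕ} (hA : A ⊆ Finset.range M) (n : ℕ)
    (f : ℕ → ℝ) :
    ∑ i ∈ cantorFinset M A (n + 1), f i =
      ∑ a ∈ A, ∑ d ∈ cantorFinset M A n, f (a + M * d) := by
  rw [cantorFinset, Finset.sum_image, Finset.sum_product]
  rintro ⟨a, d⟩ h ⟨b, e⟩ h' heq
  simp only [Finset.coe_product, Set.mem_prod, Finset.mem_coe] at h h'
  have ha := Finset.mem_range.1 (hA h.1)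
  have hb := Finset.mem_range.1 (hA h'.1)
  have hab : a = b := by
    simpa [Nat.add_mul_mod_self_left, Nat.mod_eq_of_lt, ha, hb] using congrArg (· % M) heq
  subst hab
  have hd : M * d = M * e := by simpa using heq
  rw [Nat.eq_of_mul_eq_mul_left (by omega) hd]

/-- The j-th smallest element of a set of naturals, counted from 0, is at least j, and powers of x
decrease with the exponent. -/
lemma sum_pow_le_sum_range_card {x : ℝ} (hx0 : 0 ≤ x) (hx1 : x ≤ 1) (s : Finset ℕ) :
    ∑ i ∈ s, x ^ i ≤ ∑ i ∈ Finset.range s.card, x ^ i := by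
  induction s using Finset.induction_on_max with
  | empty => simp
  | insert a s hs ih =>
    have ha : a ∉ s := fun h => lt_irrefl _ (hs a h)
    rw [Finset.sum_insert ha, Finset.card_insert_of_notMem ha, Finset.sum_range_succ, add_comm]
    refine add_le_add ih (pow_le_pow_of_le_one hx0 hx1 ?_)
    simpa using Finset.card_le_card (t := Finset.range a) fun i hi => Finset.mem_range.2 (hs i hi)

/-- The exponents are the residues of a - m modulo M, hence still distinct. -/
lemma sum_pow_cyclic_shift_le {x : ℝ} (hx0 : 0 ≤ x) (hx1 : x ≤ 1) {M m : ℕ} (hm : m < M)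
    {A : Finset ℕ} (hA : A ⊆ Finset.range M) :
    ∑ a ∈ A, x ^ (if m ≤ a then a - m else a + M - m) ≤ ∑ a ∈ canonicalAlphabet A, x ^ a := by
  have hinj : Set.InjOn (fun a => if m ≤ a then a - m else a + M - m) (A : Set ℕ) := by
    intro a ha b hb hab
    have ha := Finset.mem_range.1 (hA ha)
    have hb := Finset.mem_range.1 (hA hb)
    simp only at hab
    split_ifs at hab <;> omega
  have h := sum_pow_le_sum_range_card hx0 hx1
    (A.image fun a => if m ≤ a then a - m else a + M - m)
  rwa [Finset.sum_image hinj, Finset.card_image_of_injOn hinj] at h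

lemma canonicalAlphabet_subset {M : ℕ} {A : Finset ℕ} (hA : A ⊆ Finset.range M) :
    canonicalAlphabet A ⊆ Finset.range M := by
  have h := Finset.card_le_card hA
  rw [Finset.card_range] at h
  exact Finset.range_subset_range.2 h

/-- Among all alphabets of a given size, the canonical one maximizes the generating function of
the part of the discrete Cantor set to the right of any given point. -/
theorem sum_tail_cantorFinset_le {M : ℕ} (hM : 0 < M) {A : Finset ℕ} (hA : A ⊆ Finset.range M)
    (n m : ℕ) {x : ℝ} (hx0 : 0 ≤ x) (hx1 : x ≤ 1) :
    ∑ i ∈ cantorFinset M A n, (if m ≤ i then x ^ (i - m) else 0) ≤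
      ∑ i ∈ cantorFinset M (canonicalAlphabet A) n, x ^ i := by
  induction n generalizing m x with
  | zero =>
    simp only [cantorFinset, Finset.sum_singleton, pow_zero]
    split_ifs with h
    · simp
    · exact zero_le_one
  | succ n ih =>
    set S := ∑ i ∈ cantorFinset M (canonicalAlphabet A) n, (x ^ M) ^ i with hS
    have hS0 : 0 ≤ S := Finset.sum_nonneg fun i _ => by positivity
    -- Splitting off the lowest digit factors the generating function at x into a digit sum and the
    -- previous iterate at x ^ M; this is why the induction varies x as well as m.
    have hr : ∑ i ∈ cantorFinset M (canonicalAlphabet A) (n + 1), x ^ i =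
        (∑ a ∈ canonicalAlphabet A, x ^ a) * S := by
      rw [sum_cantorFinset_succ (canonicalAlphabet_subset hA), Finset.sum_mul, hS]
      simp only [Finset.mul_sum, pow_add, pow_mul]
    rw [hr, sum_cantorFinset_succ hA]
    refine le_trans ?_ (mul_le_mul_of_nonneg_right
      (sum_pow_cyclic_shift_le hx0 hx1 (Nat.mod_lt m hM) hA) hS0)
    rw [Finset.sum_mul]
    refine Finset.sum_le_sum fun a ha => ?_
    have haM := Finset.mem_range.1 (hA ha)
    have hdm := Nat.div_add_mod m M
    have hmM := Nat.mod_lt m hM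
    set u := m / M
    set v := m % M
    -- For a fixed lowest digit, w is the threshold that m imposes on the higher part and c the
    -- lowest digit of the difference.
    have hstep : ∀ w c : ℕ, (∀ d, m ≤ a + M * d ↔ w ≤ d) →
        (∀ d, w ≤ d → a + M * d - m = c + M * (d - w)) →
        ∑ d ∈ cantorFinset M A n, (if m ≤ a + M * d then x ^ (a + M * d - m) else 0) ≤
          x ^ c * S := by
      intro w c h1 h2
      refine le_trans (le_of_eq ?_) (mul_le_mul_of_nonneg_left
        (ih w (pow_nonneg hx0 M) (pow_le_one₀ hx0 hx1)) (pow_nonneg hx0 c))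
      rw [Finset.mul_sum]
      refine Finset.sum_congr rfl fun d _ => ?_
      by_cases hd : w ≤ d
      · rw [if_pos hd, if_pos ((h1 d).2 hd), h2 d hd, pow_add, pow_mul]
      · rw [if_neg hd, if_neg (fun h => hd ((h1 d).1 h)), mul_zero]
    -- Subtraction with m = M u + v: no borrow if v ≤ a, so the threshold is u; otherwise a borrow
    -- raises it to u + 1.
    split_ifs with hva
    · refine hstep u _ (fun d => ⟨fun h => ?_, fun h => ?_⟩) (fun d h => ?_)
      · by_contra! hlt
        have := Nat.mul_le_mul_left M (Nat.succ_le_of_lt hlt)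
        rw [Nat.mul_succ] at this
        omega
      · have := Nat.mul_le_mul_left M h
        omega
      · obtain ⟨e, rfl⟩ := Nat.exists_eq_add_of_le h
        rw [Nat.add_sub_cancel_left, Nat.mul_add]
        omega
    · refine hstep (u + 1) _ (fun d => ⟨fun h => ?_, fun h => ?_⟩) (fun d h => ?_)
      · by_contra! hlt
        have := Nat.mul_le_mul_left M (Nat.le_of_lt_succ hlt)
        omega
      · have := Nat.mul_le_mul_left M h
        rw [Nat.mul_succ] at this
        omega
      · obtain ⟨e, rfl⟩ := Nat.exists_eq_add_of_le h
        rw [Nat.add_sub_cancel_left, Nat.mul_add, Nat.mul_succ]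
        omega

/-- Abel summation: if `q` is summable and decays at most geometrically with ratio `x`, its sum
over a finite set is controlled by the tails of the generating function of the set. -/
theorem sum_le_of_tail_le {x : ℝ} {q : ℕ → ℝ} (hq0 : 0 ≤ q 0)
    (hq : ∀ i, x * q i ≤ q (i + 1)) {Q : ℝ} (hQ : HasSum q Q) {D : Finset ℕ} {c : ℝ}
    (hc : ∀ m, ∑ i ∈ D, (if m ≤ i then x ^ (i - m) else 0) ≤ c) (hc0 : 0 ≤ c) :
    ∑ i ∈ D, q i ≤ c * ((1 - x) * Q) := by
  -- The defect of q from geometric decay, with the convention q(-1) = 0; the `if` prevents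
  -- truncated subtraction from producing q 0.
  set w : ℕ → ℝ := fun i => q i - x * (if i = 0 then 0 else q (i - 1)) with hw
  have hw0 : ∀ i, 0 ≤ w i := by
    rintro (_ | i)
    · simpa [hw] using hq0
    · simpa [hw] using hq i
  have hshift : HasSum (fun i => if i = 0 then 0 else q (i - 1)) Q := by
    rw [← hasSum_nat_add_iff' 1]
    simpa using hQ
  have hws : HasSum w ((1 - x) * Q) := by
    have h := hQ.sub (hshift.mul_left x)
    rwa [← one_sub_mul] at h
  -- Inverting the recursion: q is the convolution of w with the powers of x.
  have hqw : ∀ i, q i = ∑ m ∈ Finset.range (i + 1), x ^ (i - m) * w m := by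
    intro i
    induction i with
    | zero => simp [hw]
    | succ i ih =>
      rw [Finset.sum_range_succ]
      have h : ∑ m ∈ Finset.range (i + 1), x ^ (i + 1 - m) * w m = x * q i := by
        rw [ih, Finset.mul_sum]
        refine Finset.sum_congr rfl fun m hm => ?_
        rw [Nat.succ_sub (Finset.mem_range_succ_iff.1 hm), pow_succ]
        ring
      rw [h]
      simp [hw]
  -- A common range for all i in D; the added terms m > i vanish through the `if`.
  set N := D.sup id + 1
  have hDN : ∀ i ∈ D, i < N := fun i hi => Nat.lt_succ_of_le (Finset.le_sup (f := id) hi)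
  calc ∑ i ∈ D, q i
      = ∑ i ∈ D, ∑ m ∈ Finset.range N, (if m ≤ i then x ^ (i - m) else 0) * w m := by
        refine Finset.sum_congr rfl fun i hi => ?_
        rw [hqw i]
        refine Finset.sum_subset_zero_on_sdiff
          (Finset.range_subset_range.2 (hDN i hi)) (fun m hm => ?_) (fun m hm => ?_)
        · have : ¬ m ≤ i := fun h =>
            (Finset.mem_sdiff.1 hm).2 (Finset.mem_range_succ_iff.2 h)
          rw [if_neg this, zero_mul]
        · rw [if_pos (Finset.mem_range_succ_iff.1 hm)]
    _ = ∑ m ∈ Finset.range N, (∑ i ∈ D, (if m ≤ i then x ^ (i - m) else 0)) * w m := by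
        rw [Finset.sum_comm]
        simp only [Finset.sum_mul]
    _ ≤ ∑ m ∈ Finset.range N, c * w m :=
        Finset.sum_le_sum fun m _ => mul_le_mul_of_nonneg_right (hc m) (hw0 m)
    _ = c * ∑ m ∈ Finset.range N, w m := by rw [Finset.mul_sum]
    _ ≤ c * ((1 - x) * Q) :=
        mul_le_mul_of_nonneg_left (sum_le_hasSum _ (fun i _ => hw0 i) hws) hc0

/-! ### Integrals over interval Cantor sets -/

/-- The density `r ↦ r^k / k! e^{-r}` of the Gamma distribution. -/
noncomputable def gammaDensity (k : ℕ) (r : ℝ) : ℝ :=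
  r ^ k / (k.factorial : ℝ) * Real.exp (-r)

lemma continuous_gammaDensity (k : ℕ) : Continuous (gammaDensity k) := by
  unfold gammaDensity
  fun_prop

lemma gammaDensity_nonneg (k : ℕ) {r : ℝ} (hr : 0 ≤ r) : 0 ≤ gammaDensity k r := by
  unfold gammaDensity
  positivity

/-- Only the exponential factor can decrease, since r^k is nondecreasing on [0, ∞). -/
lemma exp_neg_mul_gammaDensity_le (k : ℕ) {r δ : ℝ} (hr : 0 ≤ r) (hδ : 0 ≤ δ) :
    Real.exp (-δ) * gammaDensity k r ≤ gammaDensity k (r + δ) := by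
  unfold gammaDensity
  have h : r ^ k ≤ (r + δ) ^ k := pow_le_pow_left₀ hr (by linarith) k
  calc Real.exp (-δ) * (r ^ k / k.factorial * Real.exp (-r))
      = r ^ k / k.factorial * Real.exp (-(r + δ)) := by
        rw [neg_add, Real.exp_add]
        ring
    _ ≤ _ := by gcongr

lemma gammaDensity_eq (k : ℕ) (r : ℝ) :
    gammaDensity k r =
      (k.factorial : ℝ)⁻¹ * (Real.exp (-r) * r ^ (((k : ℝ) + 1) - 1)) := by
  rw [add_sub_cancel_right, Real.rpow_natCast, gammaDensity]
  ring

lemma integrableOn_gammaDensity (k : ℕ) : IntegrableOn (gammaDensity k) (Set.Ioi 0) := by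
  have h := (Real.GammaIntegral_convergent (s := (k : ℝ) + 1) (by positivity)).const_mul
    ((k.factorial : ℝ)⁻¹)
  exact h.congr (Filter.Eventually.of_forall fun r => (gammaDensity_eq k r).symm)

lemma integral_gammaDensity (k : ℕ) : ∫ r in Set.Ioi 0, gammaDensity k r = 1 := by
  simp only [gammaDensity_eq]
  rw [integral_const_mul, ← Real.Gamma_eq_integral (by positivity), Real.Gamma_nat_eq_factorial]
  exact inv_mul_cancel₀ (by positivity)

/-- The cells tile the half-line, so partial sums are integrals of a probability density over
initial segments. -/
lemma hasSum_integral_gammaDensity (k : ℕ) {δ : ℝ} (hδ : 0 < δ) :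
    ∃ Q ≤ 1, HasSum (fun m : ℕ => ∫ r in (δ * m)..(δ * m + δ), gammaDensity k r) Q := by
  have h0 : ∀ m : ℕ, 0 ≤ ∫ r in (δ * m)..(δ * m + δ), gammaDensity k r := fun m =>
    intervalIntegral.integral_nonneg (by linarith) fun r hr =>
      gammaDensity_nonneg k (le_trans (by positivity) hr.1)
  have h1 : ∀ N, ∑ m ∈ Finset.range N, ∫ r in (δ * m)..(δ * m + δ), gammaDensity k r ≤ 1 := by
    intro N
    have h := intervalIntegral.sum_integral_adjacent_intervals (f := gammaDensity k)
      (μ := volume) (a := fun m : ℕ => δ * m) (n := N)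
      (fun m _ => (continuous_gammaDensity k).intervalIntegrable _ _)
    simp only [Nat.cast_add, Nat.cast_one, mul_add, mul_one, Nat.cast_zero, mul_zero] at h
    rw [h, intervalIntegral.integral_of_le (by positivity), ← integral_gammaDensity k]
    refine setIntegral_mono_set (integrableOn_gammaDensity k) ?_
      (LE.le.eventuallyLE Set.Ioc_subset_Ioi_self)
    filter_upwards [ae_restrict_mem measurableSet_Ioi] with r hr
    exact gammaDensity_nonneg k (le_of_lt hr)
  have hs := summable_of_sum_range_le h0 h1
  exact ⟨_, hs.tsum_le_of_sum_range_le h1, hs.hasSum⟩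

/-! ### Eigenvalues as sums over cells -/

lemma intervalCantor_eq (n : ℕ) (L : ℝ) (M : ℕ) (A : Finset ℕ) :
    intervalCantor n L M A = ⋃ m ∈ cantorFinset M A n,
      Set.Icc (L / (M : ℝ) ^ n * (m : ℝ)) (L / (M : ℝ) ^ n * (m : ℝ) + L / (M : ℝ) ^ n) := by
  rw [intervalCantor, ← coe_cantorFinset]
  rfl

lemma cantorEigenvalue_eq_sum (k n : ℕ) {R : ℝ} (hR : 0 < R) {M : ℕ} (hM : 0 < M)
    (A : Finset ℕ) :
    cantorEigenvalue k n R M A = ∑ m ∈ cantorFinset M A n,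
      ∫ r in (Real.pi * R ^ 2 / (M : ℝ) ^ n * m)..(Real.pi * R ^ 2 / (M : ℝ) ^ n * m +
        Real.pi * R ^ 2 / (M : ℝ) ^ n), gammaDensity k r := by
  set δ := Real.pi * R ^ 2 / (M : ℝ) ^ n
  have hδ : 0 < δ := by positivity
  -- Neighbouring closed cells share endpoints; half-open cells are disjoint and differ from them by
  -- a null set.
  have hae : intervalCantor n (Real.pi * R ^ 2) M A =ᵐ[volume]
      (⋃ m ∈ cantorFinset M A n, Set.Ioc (δ * (m : ℝ)) (δ * m + δ) : Set ℝ) := by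
    rw [intervalCantor_eq]
    exact Filter.EventuallyEq.biUnion (cantorFinset M A n).finite_toSet fun m _ => Ioc_ae_eq_Icc.symm
  rw [cantorEigenvalue, setIntegral_congr_set hae]
  change ∫ r in _, gammaDensity k r = _
  rw [integral_biUnion_finset]
  · exact Finset.sum_congr rfl fun m _ => by
      rw [intervalIntegral.integral_of_le (by linarith)]
  · exact fun _ _ => measurableSet_Ioc
  · intro i _ j _ hij
    refine Set.disjoint_left.2 fun r hi hj => hij ?_
    have h : ∀ a b : ℕ, r ∈ Set.Ioc (δ * (a : ℝ)) (δ * a + δ) →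
        r ∈ Set.Ioc (δ * (b : ℝ)) (δ * b + δ) → a ≤ b := by
      intro a b ha hb
      have h1 : δ * (a : ℝ) < δ * (b + 1 : ℝ) := by
        rw [mul_add, mul_one]
        exact ha.1.trans_le hb.2
      have h2 : (a : ℝ) < b + 1 := lt_of_mul_lt_mul_left h1 hδ.le
      exact Nat.le_of_lt_succ (by exact_mod_cast h2)
    exact le_antisymm (h i j hi hj) (h j i hj hi)
  · exact fun m _ => ((continuous_gammaDensity k).integrableOn_Icc).mono_set Set.Ioc_subset_Icc_self

lemma integral_gammaDensity_zero (a b : ℝ) :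
    ∫ r in a..b, gammaDensity 0 r = Real.exp (-a) - Real.exp (-b) := by
  simp [gammaDensity]

/-- With x = e^{-δ}, the m-th cell contributes x^m (1 - x). -/
lemma cantorEigenvalue_zero_eq (n : ℕ) {R : ℝ} (hR : 0 < R) {M : ℕ} (hM : 0 < M)
    (A : Finset ℕ) :
    cantorEigenvalue 0 n R M A =
      (∑ m ∈ cantorFinset M A n, Real.exp (-(Real.pi * R ^ 2 / (M : ℝ) ^ n)) ^ m) *
        (1 - Real.exp (-(Real.pi * R ^ 2 / (M : ℝ) ^ n))) := by
  rw [cantorEigenvalue_eq_sum 0 n hR hM, Finset.sum_mul]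
  refine Finset.sum_congr rfl fun m _ => ?_
  rw [integral_gammaDensity_zero, neg_add, Real.exp_add, ← Real.exp_nat_mul]
  ring_nf

lemma cantorEigenvalue_zero_nonneg (n : ℕ) (R : ℝ) (M : ℕ) (A : Finset ℕ) :
    0 ≤ cantorEigenvalue 0 n R M A := by
  refine integral_nonneg fun r => ?_
  simp only [pow_zero, Pi.zero_apply]
  positivity

/-- Every eigenvalue for an alphabet is at most the first one for the canonical alphabet of the
same size. -/
theorem cantorEigenvalue_le (k n : ℕ) {R : ℝ} (hR : 0 < R) {M : ℕ} (hM : 0 < M)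
    {A : Finset ℕ} (hA : A ⊆ Finset.range M) :
    cantorEigenvalue k n R M A ≤ cantorEigenvalue 0 n R M (canonicalAlphabet A) := by
  rw [cantorEigenvalue_eq_sum k n hR hM, cantorEigenvalue_zero_eq n hR hM]
  set δ := Real.pi * R ^ 2 / (M : ℝ) ^ n
  have hδ : 0 < δ := by positivity
  obtain ⟨Q, hQ1, hQ⟩ := hasSum_integral_gammaDensity k hδ
  have hx0 := (Real.exp_pos (-δ)).le
  have hx1 : Real.exp (-δ) ≤ 1 := Real.exp_le_one_iff.2 (by linarith)
  set S := ∑ m ∈ cantorFinset M (canonicalAlphabet A) n, Real.exp (-δ) ^ m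
  have hS : 0 ≤ S := Finset.sum_nonneg fun i _ => by positivity
  refine (sum_le_of_tail_le (x := Real.exp (-δ)) (c := S) ?_ (fun i => ?_) hQ
    (fun m => sum_tail_cantorFinset_le hM hA n m hx0 hx1) hS).trans ?_
  · exact intervalIntegral.integral_nonneg (by linarith) fun r hr =>
      gammaDensity_nonneg k (le_trans (by simp) hr.1)
  -- Translation by δ carries each cell to the next, so the pointwise decay bound passes to the cell
  -- integrals.
  · have h := intervalIntegral.integral_comp_add_right (gammaDensity k) δ
      (a := δ * i) (b := δ * i + δ)
    push_cast
    rw [mul_add, mul_one, ← h, ← intervalIntegral.integral_const_mul]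
    refine intervalIntegral.integral_mono_on (by linarith) ?_ ?_ fun r hr =>
      exp_neg_mul_gammaDensity_le k (le_trans (by positivity) hr.1) hδ.le
    · exact ((continuous_gammaDensity k).const_mul _).intervalIntegrable _ _
    · exact ((continuous_gammaDensity k).comp (by fun_prop)).intervalIntegrable _ _
  · refine mul_le_mul_of_nonneg_left ?_ hS
    exact mul_le_of_le_one_right (by linarith) hQ1

end DaubechiesCantor

namespace DaubechiesCantor

/-! ### Time-frequency shifts of the Gaussian -/

/-- The time-frequency shift of the Gaussian to the point `z`, as an element of `L²(ℝ)`. -/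
noncomputable def coherentState (z : ℝ × ℝ) : L2R := (memLp_shift memLp_gaussian z).toLp

/-- The complex coordinate `t - iω` of a point `(ω, t)` of the time-frequency plane. -/
noncomputable def complexCoord (z : ℝ × ℝ) : ℂ := (z.2 : ℂ) - z.1 * Complex.I

/-- The short-time Fourier transform of the `k`-th Hermite function, up to a constant. -/
noncomputable def fockMonomial (k : ℕ) (z : ℝ × ℝ) : ℂ :=
  Complex.exp ((-(Real.pi * z.1 * z.2) : ℝ) * Complex.I) *
    (Real.exp (-(Real.pi / 2 * (z.1 ^ 2 + z.2 ^ 2))) : ℂ) * complexCoord z ^ k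

lemma continuous_fockMonomial (k : ℕ) : Continuous (fockMonomial k) := by
  unfold fockMonomial complexCoord
  fun_prop

lemma norm_fockMonomial (k : ℕ) (z : ℝ × ℝ) :
    ‖fockMonomial k z‖ =
      Real.exp (-(Real.pi / 2 * (z.1 ^ 2 + z.2 ^ 2))) * ‖complexCoord z‖ ^ k := by
  rw [fockMonomial, norm_mul, norm_mul, Complex.norm_exp_ofReal_mul_I, one_mul, norm_pow,
    Complex.norm_real, Real.norm_of_nonneg (Real.exp_pos _).le]

lemma norm_fockMonomial_le (k : ℕ) (z : ℝ × ℝ) :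
    ‖fockMonomial k z‖ ≤ ‖complexCoord z‖ ^ k := by
  rw [norm_fockMonomial]
  refine mul_le_of_le_one_left (by positivity) (Real.exp_le_one_iff.2 ?_)
  have := Real.pi_pos
  rw [neg_nonpos]
  positivity

/-- The phases cancel, leaving a radial weight times a monomial in the coordinate and its conjugate.
-/
lemma conj_fockMonomial_mul (j k : ℕ) (z : ℝ × ℝ) :
    conj (fockMonomial j z) * fockMonomial k z =
      (Real.exp (-(Real.pi * (z.1 ^ 2 + z.2 ^ 2))) : ℂ) *
        (conj (complexCoord z) ^ j * complexCoord z ^ k) := by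
  have h1 : conj (Complex.exp ((-(Real.pi * z.1 * z.2) : ℝ) * Complex.I)) *
      Complex.exp ((-(Real.pi * z.1 * z.2) : ℝ) * Complex.I) = 1 := by
    rw [Complex.conj_mul', Complex.norm_exp_ofReal_mul_I]
    simp
  have h2 : (Real.exp (-(Real.pi / 2 * (z.1 ^ 2 + z.2 ^ 2))) : ℂ) *
      (Real.exp (-(Real.pi / 2 * (z.1 ^ 2 + z.2 ^ 2))) : ℂ) =
      (Real.exp (-(Real.pi * (z.1 ^ 2 + z.2 ^ 2))) : ℂ) := by
    rw [← Complex.ofReal_mul, ← Real.exp_add]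
    ring_nf
  rw [fockMonomial, fockMonomial, map_mul, map_mul, map_pow, Complex.conj_ofReal, ← h2]
  linear_combination (Real.exp (-(Real.pi / 2 * (z.1 ^ 2 + z.2 ^ 2))) : ℂ) *
      (Real.exp (-(Real.pi / 2 * (z.1 ^ 2 + z.2 ^ 2))) : ℂ) *
      (conj (complexCoord z) ^ j * complexCoord z ^ k) * h1

/-- The reproducing kernel of the Gaussian transform, computed by completing the square. -/
lemma inner_coherentState (z w : ℝ × ℝ) :
    inner ℂ (coherentState z) (coherentState w) =
      fockMonomial 0 z * conj (fockMonomial 0 w) *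
        Complex.exp (Real.pi * (complexCoord z * conj (complexCoord w))) := by
  have hpi : (Real.pi : ℂ) ≠ 0 := by exact_mod_cast Real.pi_ne_zero
  have h2 : (((2 : ℝ) ^ (1 / 4 : ℝ) : ℝ) : ℂ) * (((2 : ℝ) ^ (1 / 4 : ℝ) : ℝ) : ℂ) =
      (2 : ℂ) ^ (1 / 2 : ℂ) := by
    rw [← Complex.ofReal_mul, ← Real.rpow_add two_pos, Complex.ofReal_cpow zero_le_two]
    norm_num
  have hint : inner ℂ (coherentState z) (coherentState w) =
      ∫ x : ℝ, (2 : ℂ) ^ (1 / 2 : ℂ) * Complex.exp (-(2 * Real.pi) * (x : ℂ) ^ 2 +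
        2 * Real.pi * (complexCoord z + conj (complexCoord w)) * x +
        -(Real.pi * (z.2 ^ 2 + w.2 ^ 2))) := by
    rw [L2.inner_def]
    refine integral_congr_ae ?_
    filter_upwards [(memLp_shift memLp_gaussian z).coeFn_toLp,
      (memLp_shift memLp_gaussian w).coeFn_toLp] with x hz hw
    rw [coherentState, coherentState, hz, hw, RCLike.inner_apply, shift, shift, map_mul,
      ← Complex.exp_conj, map_mul, Complex.conj_ofReal, Complex.conj_I, gaussian, gaussian,
      Complex.conj_ofReal, ← h2]
    push_cast
    have : ∀ a b c d e : ℂ, a * Complex.exp b * Complex.exp c * (a * Complex.exp d * Complex.exp e)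
        = a * a * Complex.exp (b + c + d + e) := fun a b c d e => by
      simp only [Complex.exp_add]
      ring
    rw [this]
    congr 2
    simp only [complexCoord, map_sub, map_mul, Complex.conj_ofReal, Complex.conj_I]
    ring
  have hre : (-(2 * Real.pi) : ℂ).re < 0 := by
    simpa using Real.pi_pos
  -- The normalization 2^{1/4} of the window, squared, cancels the Gaussian integral's factor (π /
  -- 2π)^{1/2}.
  have hone : (2 : ℂ) ^ (1 / 2 : ℂ) * ((Real.pi : ℂ) / -(-(2 * Real.pi))) ^ (1 / 2 : ℂ) = 1 := by
    have : (Real.pi : ℂ) / -(-(2 * Real.pi)) = ((1 / 2 : ℝ) : ℂ) := by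
      push_cast
      field_simp
    rw [this, show (2 : ℂ) = ((2 : ℝ) : ℂ) by norm_num,
      ← Complex.mul_cpow_ofReal_nonneg (by norm_num) (by norm_num), ← Complex.ofReal_mul]
    norm_num
  rw [hint, integral_const_mul, integral_cexp_quadratic hre, ← mul_assoc, hone, one_mul,
    fockMonomial, fockMonomial, pow_zero, pow_zero, mul_one, mul_one, map_mul, Complex.conj_ofReal,
    ← Complex.exp_conj, Complex.ofReal_exp, Complex.ofReal_exp, ← Complex.exp_add,
    ← Complex.exp_add, ← Complex.exp_add, ← Complex.exp_add]
  congr 1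
  simp only [complexCoord, map_sub, map_mul, Complex.conj_ofReal, Complex.conj_I]
  push_cast
  field_simp
  ring_nf
  simp only [Complex.I_sq]
  ring

lemma hasSum_inner_coherentState (z w : ℝ × ℝ) :
    HasSum (fun k : ℕ => ((Real.pi ^ k / k.factorial : ℝ) : ℂ) *
      (fockMonomial k z * conj (fockMonomial k w)))
      (inner ℂ (coherentState z) (coherentState w)) := by
  rw [inner_coherentState, Complex.exp_eq_exp_ℂ]
  refine ((NormedSpace.expSeries_div_hasSum_exp (Real.pi * (complexCoord z *
    conj (complexCoord w)) : ℂ)).mul_left (fockMonomial 0 z *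
      conj (fockMonomial 0 w))).congr_fun ?_
  intro k
  have h : ∀ v, fockMonomial k v = fockMonomial 0 v * complexCoord v ^ k := fun v => by
    rw [fockMonomial, fockMonomial, pow_zero, mul_one]
  rw [h z, h w, map_mul, map_pow]
  push_cast
  rw [mul_pow, mul_pow]
  ring

/-! ### The Gaussian as the coherent state at the origin -/

lemma shift_gaussian_zero : shift gaussian 0 = gaussian := by
  funext x
  simp [shift]

lemma coherentState_zero : coherentState 0 = gaussianL2 := by
  unfold coherentState gaussianL2
  congr 1
  exact shift_gaussian_zero

lemma fockMonomial_zero_zero : fockMonomial 0 0 = 1 := by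
  simp [fockMonomial]

lemma inner_self_eq_ofReal_norm_sq {H : Type*} [NormedAddCommGroup H] [InnerProductSpace ℂ H]
    (v : H) : inner ℂ v v = ((‖v‖ ^ 2 : ℝ) : ℂ) := by
  rw [inner_self_eq_norm_sq_to_K, Complex.ofReal_pow]
  rfl

lemma norm_gaussianL2 : ‖gaussianL2‖ = 1 := by
  have h : inner ℂ gaussianL2 gaussianL2 = (1 : ℂ) := by
    rw [← coherentState_zero, inner_coherentState, fockMonomial_zero_zero]
    simp [complexCoord]
  rw [inner_self_eq_ofReal_norm_sq] at h
  have h' : ‖gaussianL2‖ ^ 2 = 1 := by exact_mod_cast h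
  exact (pow_eq_one_iff_of_nonneg (norm_nonneg _) two_ne_zero).1 h'

lemma stft_gaussianL2 (z : ℝ × ℝ) : stft gaussian gaussianL2 z = fockMonomial 0 z := by
  rw [stft_eq_inner memLp_gaussian]
  change inner ℂ (coherentState z) gaussianL2 = _
  rw [← coherentState_zero, inner_coherentState, fockMonomial_zero_zero]
  simp [complexCoord]

/-! ### The operator norm of radial localization operators -/

/-- Bessel's inequality for an orthogonal, not necessarily normalized family. -/
lemma sum_mul_norm_inner_sq_le {H : Type*} [NormedAddCommGroup H] [InnerProductSpace ℂ H]
    {e : ℕ → H} (horth : ∀ j k, j ≠ k → inner ℂ (e j) (e k) = 0) {a : ℕ → ℝ}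
    (ha : ∀ k, 0 ≤ a k) {c : ℝ} (hac : ∀ k, a k * ‖e k‖ ^ 2 ≤ c) (g : H)
    (s : Finset ℕ) : ∑ k ∈ s, a k * ‖inner ℂ (e k) g‖ ^ 2 ≤ c * ‖g‖ ^ 2 := by
  set S := ∑ k ∈ s, a k * ‖inner ℂ (e k) g‖ ^ 2 with hS
  have hS0 : 0 ≤ S := Finset.sum_nonneg fun k _ => mul_nonneg (ha k) (sq_nonneg _)
  have hc0 : 0 ≤ c := (mul_nonneg (ha 0) (sq_nonneg _)).trans (hac 0)
  -- Pairing v with g gives S, while orthogonality gives ‖v‖² ≤ c S; Cauchy–Schwarz then yields S² ≤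
  -- c S ‖g‖².
  set v := ∑ k ∈ s, ((a k : ℂ) * inner ℂ (e k) g) • e k with hv
  have hvg : inner ℂ v g = (S : ℂ) := by
    rw [hv, sum_inner, hS, Complex.ofReal_sum]
    refine Finset.sum_congr rfl fun k _ => ?_
    rw [inner_smul_left, map_mul, Complex.conj_ofReal, mul_assoc, Complex.conj_mul']
    push_cast
    rfl
  have hvv : ‖v‖ ^ 2 ≤ c * S := by
    have h : inner ℂ v v = ((∑ k ∈ s, a k * ‖e k‖ ^ 2 * (a k * ‖inner ℂ (e k) g‖ ^ 2) : ℝ) : ℂ) := by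
      conv_lhs => rw [hv]
      rw [sum_inner, Complex.ofReal_sum]
      refine Finset.sum_congr rfl fun k hk => ?_
      rw [inner_smul_left, inner_sum, Finset.sum_eq_single_of_mem k hk]
      · rw [inner_smul_right, inner_self_eq_ofReal_norm_sq, map_mul, Complex.conj_ofReal]
        have := Complex.conj_mul' (inner ℂ (e k) g)
        push_cast
        linear_combination (a k : ℂ) ^ 2 * (‖e k‖ : ℂ) ^ 2 * this
      · intro j _ hj
        rw [inner_smul_right, horth k j hj.symm, mul_zero]
    rw [inner_self_eq_ofReal_norm_sq] at h
    have h' := Complex.ofReal_injective h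
    rw [h', hS, Finset.mul_sum]
    exact Finset.sum_le_sum fun k _ =>
      mul_le_mul_of_nonneg_right (hac k) (mul_nonneg (ha k) (sq_nonneg _))
  have hle : S ≤ ‖v‖ * ‖g‖ := by
    have := norm_inner_le_norm (𝕜 := ℂ) v g
    rwa [hvg, Complex.norm_real, Real.norm_of_nonneg hS0] at this
  have hsq : S ^ 2 ≤ c * S * ‖g‖ ^ 2 := by
    calc S ^ 2 ≤ (‖v‖ * ‖g‖) ^ 2 := pow_le_pow_left₀ hS0 hle 2
      _ = ‖v‖ ^ 2 * ‖g‖ ^ 2 := mul_pow _ _ _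
      _ ≤ _ := mul_le_mul_of_nonneg_right hvv (sq_nonneg _)
  rcases hS0.eq_or_lt with h | h
  · rw [← h]
    positivity
  · refine le_of_mul_le_mul_left (a := S) ?_ h
    linarith [hsq, sq S]

lemma inner_localizationOperator_indicator {E : Set (ℝ × ℝ)} (hE : MeasurableSet E)
    {P : L2R →L[ℂ] L2R}
    (hP : IsLocalizationOperator (E.indicator fun _ => 1) gaussian P) (f g : L2R) :
    inner ℂ g (P f) = ∫ z in E, stft gaussian f z * conj (stft gaussian g z) := by
  rw [hP f g, ← integral_indicator hE]
  refine integral_congr_ae (Filter.Eventually.of_forall fun z => ?_)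
  by_cases hz : z ∈ E <;> simp [hz]

/-- If the functions `fockMonomial k` are orthogonal on a bounded set, the norm of the localization
operator is at most any bound for their (suitably scaled) squared norms on the set. -/
theorem norm_le_of_orthogonal_fockMonomial {E : Set (ℝ × ℝ)} (hE : MeasurableSet E)
    (hfin : volume E ≠ ⊤) {ρ : ℝ} (hρ : ∀ z ∈ E, ‖complexCoord z‖ ≤ ρ) {P : L2R →L[ℂ] L2R}
    (hP : IsLocalizationOperator (E.indicator fun _ => 1) gaussian P) {l : ℕ → ℝ} {c : ℝ}
    (horth : ∀ j k, j ≠ k → ∫ z in E, conj (fockMonomial j z) * fockMonomial k z = 0)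
    (hdiag : ∀ k, ∫ z in E, conj (fockMonomial k z) * fockMonomial k z =
      ((k.factorial / Real.pi ^ k * l k : ℝ) : ℂ)) (hc0 : 0 ≤ c) (hc : ∀ k, l k ≤ c) :
    ‖P‖ ≤ c := by
  -- With g the transform of f on E and d_k its pairings with the monomials in L²(E), the chain is
  -- ‖P f‖² = ∑ a_k |d_k|² ≤ c ‖g‖² = c ⟨f, P f⟩ ≤ c ‖f‖ ‖P f‖.
  refine P.opNorm_le_bound hc0 fun f => ?_
  set μ : Measure (ℝ × ℝ) := volume.restrict E with hμ
  have : IsFiniteMeasure μ := ⟨by rw [hμ, Measure.restrict_apply_univ]; exact hfin.lt_top⟩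
  set a : ℕ → ℝ := fun k => Real.pi ^ k / k.factorial with ha
  have ha0 : ∀ k, 0 ≤ a k := fun k => div_nonneg (pow_nonneg Real.pi_pos.le k) (by positivity)
  set g : ℝ × ℝ → ℂ := stft gaussian f with hg
  have hgm : AEStronglyMeasurable g μ :=
    (stronglyMeasurable_stft memLp_gaussian f).aestronglyMeasurable
  obtain ⟨B, hB⟩ : ∃ B, ∀ z, ‖g z‖ ≤ B := ⟨_, norm_stft_le memLp_gaussian f⟩
  have hψm : ∀ k, AEStronglyMeasurable (fockMonomial k) μ := fun k =>
    (continuous_fockMonomial k).aestronglyMeasurable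
  have hψb : ∀ k, ∀ᵐ z ∂μ, ‖fockMonomial k z‖ ≤ ρ ^ k := fun k => by
    filter_upwards [ae_restrict_mem hE] with z hz
    exact (norm_fockMonomial_le k z).trans (pow_le_pow_left₀ (norm_nonneg _) (hρ z hz) k)
  have hgL : MemLp g 2 μ := MemLp.of_bound hgm B (Filter.Eventually.of_forall hB)
  have hψL : ∀ k, MemLp (fockMonomial k) 2 μ := fun k => MemLp.of_bound (hψm k) _ (hψb k)
  have hinner : ∀ {u v : ℝ × ℝ → ℂ} (hu : MemLp u 2 μ) (hv : MemLp v 2 μ),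
      inner ℂ hu.toLp hv.toLp = ∫ z, conj (u z) * v z ∂μ := by
    intro u v hu hv
    rw [L2.inner_def]
    refine integral_congr_ae ?_
    filter_upwards [hu.coeFn_toLp, hv.coeFn_toLp] with z h1 h2
    rw [h1, h2, RCLike.inner_apply, mul_comm]
  set d : ℕ → ℂ := fun k => ∫ z, g z * conj (fockMonomial k z) ∂μ with hd
  have hd_inner : ∀ k, inner ℂ (hψL k).toLp hgL.toLp = d k := fun k => by
    rw [hinner, hd]
    simp only [mul_comm]
  -- the short-time Fourier transform of `P f`
  have hstft : ∀ w, HasSum (fun k => (a k : ℂ) * (d k * fockMonomial k w))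
      (stft gaussian (P f : L2R) w) := by
    intro w
    rw [stft_eq_inner memLp_gaussian]
    change HasSum _ (inner ℂ (coherentState w) (P f))
    rw [inner_localizationOperator_indicator hE hP]
    -- On E the k-th monomial is at most ρ^k, so the factorial in a_k makes the bounds an
    -- exponential series, and E has finite measure.
    have h := hasSum_integral_of_dominated_convergence (μ := μ)
      (F := fun k z => g z * conj ((a k : ℂ) * (fockMonomial k z * conj (fockMonomial k w))))
      (f := fun z => g z * conj (stft gaussian (coherentState w) z))
      (fun k _ => B * ((Real.pi * (ρ * ‖complexCoord w‖)) ^ k / k.factorial)) ?_ ?_ ?_ ?_ ?_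
    · refine h.congr_fun fun k => ?_
      rw [hd, ← integral_mul_const, ← integral_const_mul]
      refine integral_congr_ae (Filter.Eventually.of_forall fun z => ?_)
      simp only [map_mul, Complex.conj_conj, Complex.conj_ofReal]
      ring
    · intro k
      exact hgm.mul (Complex.continuous_conj.comp_aestronglyMeasurable
        (((hψm k).mul_const _).const_mul _))
    · intro k
      filter_upwards [hψb k] with z hz
      rw [norm_mul, RCLike.norm_conj, norm_mul, norm_mul, RCLike.norm_conj, Complex.norm_real,
        Real.norm_of_nonneg (ha0 k)]
      have h1 : a k * (‖fockMonomial k z‖ * ‖fockMonomial k w‖) ≤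
          a k * (ρ ^ k * ‖complexCoord w‖ ^ k) :=
        mul_le_mul_of_nonneg_left (mul_le_mul hz (norm_fockMonomial_le k w) (norm_nonneg _)
          ((norm_nonneg _).trans hz)) (ha0 k)
      refine (mul_le_mul (hB z) h1 (mul_nonneg (ha0 k) (by positivity))
        ((norm_nonneg _).trans (hB z))).trans (le_of_eq ?_)
      rw [ha, mul_pow, mul_pow]
      ring
    · exact Filter.Eventually.of_forall fun _ => (Real.summable_pow_div_factorial _).mul_left B
    · exact integrable_const _
    · refine Filter.Eventually.of_forall fun z => ?_
      refine HasSum.mul_left _ ?_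
      rw [stft_eq_inner memLp_gaussian]
      exact Complex.hasSum_conj'.2 (hasSum_inner_coherentState z w)
  have hdb : ∀ k, ‖d k‖ ≤ B * ρ ^ k * μ.real Set.univ := fun k => by
    refine norm_integral_le_of_norm_le_const ?_
    filter_upwards [hψb k] with z hz
    rw [norm_mul, RCLike.norm_conj]
    exact mul_le_mul (hB z) hz (norm_nonneg _) ((norm_nonneg _).trans (hB z))
  -- The weak definition is tested against P f itself, whose transform has just been expanded.
  have hsum : HasSum (fun k => ((a k * ‖d k‖ ^ 2 : ℝ) : ℂ)) (inner ℂ (P f) (P f)) := by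
    rw [inner_localizationOperator_indicator hE hP]
    have h := hasSum_integral_of_dominated_convergence (μ := μ)
      (F := fun k z => g z * conj ((a k : ℂ) * (d k * fockMonomial k z)))
      (f := fun z => g z * conj (stft gaussian (P f : L2R) z))
      (fun k _ => B * B * μ.real Set.univ * ((Real.pi * (ρ * ρ)) ^ k / k.factorial)) ?_ ?_ ?_ ?_ ?_
    · refine h.congr_fun fun k => ?_
      have h2 : (fun z => g z * conj ((a k : ℂ) * (d k * fockMonomial k z))) =
          fun z => (a k : ℂ) * conj (d k) * (g z * conj (fockMonomial k z)) := by
        funext z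
        simp only [map_mul, Complex.conj_ofReal]
        ring
      rw [h2, integral_const_mul]
      change _ = (a k : ℂ) * conj (d k) * d k
      rw [mul_assoc, Complex.conj_mul']
      push_cast
      rfl
    · intro k
      exact hgm.mul (Complex.continuous_conj.comp_aestronglyMeasurable
        (((hψm k).const_mul _).const_mul _))
    · intro k
      filter_upwards [hψb k] with z hz
      rw [norm_mul, RCLike.norm_conj, norm_mul, norm_mul, Complex.norm_real,
        Real.norm_of_nonneg (ha0 k)]
      have h1 : a k * (‖d k‖ * ‖fockMonomial k z‖) ≤
          a k * (B * ρ ^ k * μ.real Set.univ * ρ ^ k) :=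
        mul_le_mul_of_nonneg_left (mul_le_mul (hdb k) hz (norm_nonneg _)
          ((norm_nonneg _).trans (hdb k))) (ha0 k)
      refine (mul_le_mul (hB z) h1 (mul_nonneg (ha0 k) (by positivity))
        ((norm_nonneg _).trans (hB z))).trans (le_of_eq ?_)
      rw [ha, mul_pow, mul_pow]
      ring
    · exact Filter.Eventually.of_forall fun _ => (Real.summable_pow_div_factorial _).mul_left _
    · exact integrable_const _
    · refine Filter.Eventually.of_forall fun z => ?_
      refine HasSum.mul_left _ ?_
      exact Complex.hasSum_conj'.2 (hstft z)
  have hsum' : HasSum (fun k => a k * ‖d k‖ ^ 2) (‖(P f : L2R)‖ ^ 2) := by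
    rw [inner_self_eq_ofReal_norm_sq] at hsum
    exact Complex.hasSum_ofReal.1 hsum
  have hbessel : ∀ s : Finset ℕ, ∑ k ∈ s, a k * ‖d k‖ ^ 2 ≤ c * ‖hgL.toLp‖ ^ 2 := by
    intro s
    have h := sum_mul_norm_inner_sq_le (e := fun k => (hψL k).toLp) (a := a) (c := c)
      (fun j k hjk => by rw [hinner]; exact horth j k hjk) ha0 (fun k => ?_) hgL.toLp s
    · simpa only [hd_inner] using h
    · have h1 : ‖(hψL k).toLp‖ ^ 2 = k.factorial / Real.pi ^ k * l k := by
        have h2 := hinner (hψL k) (hψL k)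
        rw [hdiag k, inner_self_eq_ofReal_norm_sq] at h2
        exact Complex.ofReal_injective h2
      have hpi := Real.pi_ne_zero
      have h3 : a k * ‖(hψL k).toLp‖ ^ 2 = l k := by
        rw [h1, ha]
        field_simp
      exact h3.trans_le (hc k)
  have hnorm : ‖(P f : L2R)‖ ^ 2 ≤ c * ‖hgL.toLp‖ ^ 2 := by
    exact le_of_tendsto' hsum' hbessel
  have hg2 : ‖hgL.toLp‖ ^ 2 ≤ ‖f‖ * ‖(P f : L2R)‖ := by
    have h1 := hinner hgL hgL
    have h2 := inner_localizationOperator_indicator hE hP f f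
    have h3 : ((‖hgL.toLp‖ ^ 2 : ℝ) : ℂ) = inner ℂ f (P f) := by
      rw [h2, ← inner_self_eq_ofReal_norm_sq, h1]
      simp only [mul_comm, hg, hμ]
    have h4 := norm_inner_le_norm (𝕜 := ℂ) f (P f)
    rwa [← h3, Complex.norm_real, Real.norm_of_nonneg (by positivity)] at h4
  have hfinal : ‖(P f : L2R)‖ ^ 2 ≤ c * (‖f‖ * ‖(P f : L2R)‖) :=
    hnorm.trans (mul_le_mul_of_nonneg_left hg2 hc0)
  rcases (norm_nonneg (P f : L2R)).eq_or_lt with h | h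
  · rw [← h]
    positivity
  · refine le_of_mul_le_mul_right (a := ‖(P f : L2R)‖) ?_ h
    linarith [sq ‖(P f : L2R)‖]

end DaubechiesCantor

namespace DaubechiesCantor

/-! ### Radial integrals and the main theorem -/

lemma integral_exp_int_mul_eq_zero {m : ℤ} (hm : m ≠ 0) :
    ∫ θ in Set.Ioo (-Real.pi) Real.pi, Complex.exp ((m : ℂ) * Complex.I * θ) = 0 := by
  have hmI : (m : ℂ) * Complex.I ≠ 0 :=
    mul_ne_zero (by exact_mod_cast hm) Complex.I_ne_zero
  rw [← integral_Ioc_eq_integral_Ioo,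
    ← intervalIntegral.integral_of_le (by linarith [Real.pi_pos]), integral_exp_mul_complex hmI,
    div_eq_zero_iff]
  refine Or.inl (sub_eq_zero.2 ?_)
  rw [Complex.exp_eq_exp_iff_exists_int]
  exact ⟨m, by push_cast; ring⟩

lemma complexCoord_polar (p : ℝ × ℝ) :
    complexCoord (polarCoord.symm p) = -Complex.I * (p.1 * Complex.exp (p.2 * Complex.I)) := by
  rw [Complex.exp_mul_I, polarCoord_symm_apply, complexCoord]
  push_cast
  ring_nf
  rw [Complex.I_sq]
  ring

/-- In polar coordinates the angular factor e^{i(k-j)θ} integrates to 0 off the diagonal and to 2π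
on it; the substitution y = r² absorbs the 2. -/
lemma integral_radial_mul_monomial (H : ℝ → ℝ) (j k : ℕ) :
    ∫ z : ℝ × ℝ, (H (z.1 ^ 2 + z.2 ^ 2) : ℂ) *
        (conj (complexCoord z) ^ j * complexCoord z ^ k) =
      if j = k then ((Real.pi * ∫ y in Set.Ioi 0, H y * y ^ k : ℝ) : ℂ) else 0 := by
  rw [← integral_comp_polarCoord_symm]
  have hint : ∀ p : ℝ × ℝ, p.1 • ((H ((polarCoord.symm p).1 ^ 2 + (polarCoord.symm p).2 ^ 2) : ℂ) *
      (conj (complexCoord (polarCoord.symm p)) ^ j * complexCoord (polarCoord.symm p) ^ k)) =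
      ((p.1 * H (p.1 ^ 2) * p.1 ^ (j + k) : ℝ) : ℂ) * (Complex.I ^ j * (-Complex.I) ^ k *
        Complex.exp ((((k : ℤ) - (j : ℤ) : ℤ) : ℂ) * Complex.I * p.2)) := by
    intro p
    have h1 : (polarCoord.symm p).1 ^ 2 + (polarCoord.symm p).2 ^ 2 = p.1 ^ 2 := by
      rw [polarCoord_symm_apply]
      linear_combination p.1 ^ 2 * Real.cos_sq_add_sin_sq p.2
    have h2 : conj (complexCoord (polarCoord.symm p)) =
        Complex.I * (p.1 * Complex.exp (-(p.2 * Complex.I))) := by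
      rw [complexCoord_polar, map_mul, map_mul, ← Complex.exp_conj, map_mul, map_neg,
        Complex.conj_I, Complex.conj_ofReal, Complex.conj_ofReal, neg_neg, mul_neg]
    have h3 : Complex.exp ((((k : ℤ) - (j : ℤ) : ℤ) : ℂ) * Complex.I * p.2) =
        Complex.exp (-(p.2 * Complex.I)) ^ j * Complex.exp (p.2 * Complex.I) ^ k := by
      rw [← Complex.exp_nat_mul, ← Complex.exp_nat_mul, ← Complex.exp_add]
      push_cast
      ring_nf
    rw [h1, h2, h3, complexCoord_polar, Complex.real_smul]
    push_cast
    ring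
  simp only [hint]
  rw [polarCoord_target, Measure.volume_eq_prod, setIntegral_prod_mul (fun r : ℝ =>
    ((r * H (r ^ 2) * r ^ (j + k) : ℝ) : ℂ)) (fun θ : ℝ => Complex.I ^ j * (-Complex.I) ^ k *
        Complex.exp ((((k : ℤ) - (j : ℤ) : ℤ) : ℂ) * Complex.I * θ)), integral_const_mul]
  split_ifs with h
  · subst h
    have hI : Complex.I ^ j * (-Complex.I) ^ j = 1 := by
      rw [← mul_pow]
      simp
    have hθ : ∫ θ : ℝ in Set.Ioo (-Real.pi) Real.pi,
        Complex.exp ((((j : ℤ) - (j : ℤ) : ℤ) : ℂ) * Complex.I * θ) = 2 * Real.pi := by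
      simp [Real.pi_pos.le]
      ring
    have hr := integral_comp_rpow_Ioi (fun y => H y * y ^ j) two_ne_zero
    rw [hI, hθ, integral_complex_ofReal, ← hr, one_mul,
      show (2 * Real.pi : ℂ) = ((2 * Real.pi : ℝ) : ℂ) by push_cast; rfl, ← Complex.ofReal_mul]
    congr 1
    rw [mul_comm, mul_comm 2 Real.pi, mul_assoc, ← integral_const_mul]
    congr 1
    refine setIntegral_congr_fun measurableSet_Ioi fun r _ => ?_
    simp only [smul_eq_mul]
    norm_num
    ring
  · rw [integral_exp_int_mul_eq_zero (by omega), mul_zero, mul_zero]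

lemma mul_mem_intervalCantor {c : ℝ} (hc : 0 < c) (n : ℕ) (L : ℝ) (M : ℕ) (A : Finset ℕ) (y : ℝ) :
    c * y ∈ intervalCantor n (c * L) M A ↔ y ∈ intervalCantor n L M A := by
  simp only [intervalCantor, Set.mem_iUnion, Set.mem_Icc, exists_prop]
  refine exists_congr fun m => and_congr_right fun _ => ?_
  have h1 : c * L / (M : ℝ) ^ n * m = c * (L / (M : ℝ) ^ n * m) := by ring
  have h2 : c * L / (M : ℝ) ^ n * m + c * L / (M : ℝ) ^ n =
      c * (L / (M : ℝ) ^ n * m + L / (M : ℝ) ^ n) := by ring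
  rw [h2, h1, mul_le_mul_iff_right₀ hc, mul_le_mul_iff_right₀ hc]

lemma intervalCantor_subset_Ici (n : ℕ) {L : ℝ} (hL : 0 ≤ L) (M : ℕ) (A : Finset ℕ) :
    intervalCantor n L M A ⊆ Set.Ici 0 := by
  intro y hy
  simp only [intervalCantor, Set.mem_iUnion, Set.mem_Icc, exists_prop] at hy
  obtain ⟨m, -, h, -⟩ := hy
  exact le_trans (by positivity) h

/-- Substitute r = π y: the Jacobian cancels the leading π, and y^k supplies π^{-k}. -/
lemma integral_indicator_intervalCantor (k n : ℕ) (R : ℝ) (M : ℕ) (A : Finset ℕ) :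
    Real.pi * ∫ y in Set.Ioi 0, (intervalCantor n (R ^ 2) M A).indicator
        (fun y => Real.exp (-(Real.pi * y))) y * y ^ k =
      k.factorial / Real.pi ^ k * cantorEigenvalue k n R M A := by
  set C := intervalCantor n (Real.pi * R ^ 2) M A with hC
  have hCm : MeasurableSet C := (isCompact_intervalCantor _ _ _ _).measurableSet
  have hpi := Real.pi_pos
  have h1 : ∫ r in Set.Ioi 0, C.indicator (gammaDensity k) r = cantorEigenvalue k n R M A := by
    rw [← integral_Ici_eq_integral_Ioi, setIntegral_indicator hCm, Set.inter_eq_right.2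
      (intervalCantor_subset_Ici n (by positivity) M A)]
    rfl
  have h2 := integral_comp_mul_left_Ioi (C.indicator (gammaDensity k)) 0 hpi
  rw [mul_zero, h1, smul_eq_mul] at h2
  have h3 : ∀ y, (intervalCantor n (R ^ 2) M A).indicator
      (fun y => Real.exp (-(Real.pi * y))) y * y ^ k =
      k.factorial / Real.pi ^ k * C.indicator (gammaDensity k) (Real.pi * y) := by
    intro y
    by_cases hy : y ∈ intervalCantor n (R ^ 2) M A
    · rw [Set.indicator_of_mem hy, Set.indicator_of_mem
        ((mul_mem_intervalCantor hpi n (R ^ 2) M A y).2 hy), gammaDensity]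
      rw [mul_pow]
      have : (k.factorial : ℝ) ≠ 0 := by positivity
      field_simp
    · rw [Set.indicator_of_notMem hy, Set.indicator_of_notMem
        (fun h => hy ((mul_mem_intervalCantor hpi n (R ^ 2) M A y).1 h)), zero_mul, mul_zero]
  simp only [h3]
  rw [integral_const_mul, h2]
  field_simp

lemma integral_conj_fockMonomial_mul (j k n : ℕ) (R : ℝ) (M : ℕ) (A : Finset ℕ) :
    ∫ z in sphericalCantor n R M A, conj (fockMonomial j z) * fockMonomial k z =
      if j = k then ((k.factorial / Real.pi ^ k * cantorEigenvalue k n R M A : ℝ) : ℂ) else 0 := by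
  rw [← integral_indicator_intervalCantor, ← integral_radial_mul_monomial,
    ← integral_indicator (isCompact_sphericalCantor n R M A).measurableSet]
  refine integral_congr_ae (Filter.Eventually.of_forall fun z => ?_)
  by_cases hz : z.1 ^ 2 + z.2 ^ 2 ∈ intervalCantor n (R ^ 2) M A
  · have hz' : z ∈ sphericalCantor n R M A := hz
    simp only [Set.indicator_of_mem hz, Set.indicator_of_mem hz', conj_fockMonomial_mul]
  · have hz' : z ∉ sphericalCantor n R M A := hz
    simp only [Set.indicator_of_notMem hz, Set.indicator_of_notMem hz', Complex.ofReal_zero,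
      zero_mul]

/-! ### Norm and quadratic form of the Cantor operators -/

lemma isLocalizationOperator_cantorOperator (n : ℕ) (R : ℝ) (M : ℕ) (A : Finset ℕ) :
    IsLocalizationOperator ((sphericalCantor n R M A).indicator fun _ => 1) gaussian
      (cantorOperator n R M A) :=
  localizationOperator_spec _ _ (integrable_cantorWeight n R M A) memLp_gaussian

/-- The norm of the localization operator is at most any bound for its eigenvalues. -/
theorem norm_cantorOperator_le (n : ℕ) (R : ℝ) (M : ℕ) (A : Finset ℕ) {c : ℝ} (hc0 : 0 ≤ c)
    (hc : ∀ k, cantorEigenvalue k n R M A ≤ c) : ‖cantorOperator n R M A‖ ≤ c := by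
  have hE := isCompact_sphericalCantor n R M A
  have hcont : Continuous complexCoord := by
    unfold complexCoord
    fun_prop
  obtain ⟨ρ, hρ⟩ := hE.exists_bound_of_continuousOn hcont.continuousOn
  refine norm_le_of_orthogonal_fockMonomial hE.measurableSet hE.measure_lt_top.ne hρ
    (isLocalizationOperator_cantorOperator n R M A) (l := fun k => cantorEigenvalue k n R M A)
    (fun j k hjk => ?_) (fun k => ?_) hc0 hc
  · rw [integral_conj_fockMonomial_mul, if_neg hjk]
  · rw [integral_conj_fockMonomial_mul, if_pos rfl]

lemma inner_cantorOperator_gaussianL2 (n : ℕ) (R : ℝ) (M : ℕ) (A : Finset ℕ) :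
    inner ℂ gaussianL2 (cantorOperator n R M A gaussianL2) =
      ((cantorEigenvalue 0 n R M A : ℝ) : ℂ) := by
  rw [inner_localizationOperator_indicator (isCompact_sphericalCantor n R M A).measurableSet
    (isLocalizationOperator_cantorOperator n R M A)]
  have h := integral_conj_fockMonomial_mul 0 0 n R M A
  simp only [if_true, Nat.factorial_zero, Nat.cast_one, pow_zero, div_one, one_mul] at h
  rw [← h]
  simp only [stft_gaussianL2, mul_comm]

/-- A unit vector at which the quadratic form of an operator attains a bound for the norm of the
operator is an eigenvector. -/
lemma apply_eq_smul_of_norm_le {H : Type*} [NormedAddCommGroup H] [InnerProductSpace ℂ H]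
    {P : H →L[ℂ] H} {c : ℝ} (hP : ‖P‖ ≤ c) {v : H} (hv : ‖v‖ = 1)
    (hvP : inner ℂ v (P v) = (c : ℂ)) : P v = (c : ℂ) • v := by
  have hPv : ‖P v‖ ≤ c := by
    have h := P.le_of_opNorm_le hP v
    rwa [hv, mul_one] at h
  have hre : RCLike.re (inner ℂ (P v) ((c : ℂ) • v)) = c ^ 2 := by
    rw [inner_smul_right, ← inner_conj_symm, hvP, Complex.conj_ofReal, ← Complex.ofReal_mul]
    simp [sq]
  -- Here ‖P v - c v‖² = ‖P v‖² - 2c² + c² ≤ 0.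
  have h := norm_sub_sq (𝕜 := ℂ) (P v) ((c : ℂ) • v)
  rw [hre, norm_smul, hv, mul_one, Complex.norm_real, Real.norm_eq_abs, sq_abs] at h
  have h2 : ‖P v‖ ^ 2 ≤ c ^ 2 := pow_le_pow_left₀ (norm_nonneg _) hPv 2
  have h3 : ‖P v - (c : ℂ) • v‖ ^ 2 = 0 := le_antisymm (by linarith) (sq_nonneg _)
  exact sub_eq_zero.1 (norm_eq_zero.1 (pow_eq_zero_iff two_ne_zero |>.1 h3))

end DaubechiesCantor

theorem mainTheorem1 (M : ℕ) (A : Finset ℕ) (hA : A.Nonempty) (hAM : A ⊂ Finset.range M)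
    (R : ℝ) (hR : 0 < R) (n : ℕ) :
    ‖DaubechiesCantor.cantorOperator n R M A‖ ≤
        2 * DaubechiesCantor.cantorEigenvalue 0 n R M (DaubechiesCantor.canonicalAlphabet A) ∧
      ‖DaubechiesCantor.cantorOperator n R M (DaubechiesCantor.canonicalAlphabet A)‖ =
        DaubechiesCantor.cantorEigenvalue 0 n R M (DaubechiesCantor.canonicalAlphabet A) ∧
      Module.End.HasEigenvector
        (DaubechiesCantor.cantorOperator n R M
          (DaubechiesCantor.canonicalAlphabet A)).toLinearMap
        ((DaubechiesCantor.cantorEigenvalue 0 n R M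
          (DaubechiesCantor.canonicalAlphabet A) : ℝ) : ℂ)
        DaubechiesCantor.gaussianL2 ∧
      IsGreatest
        {μ : ℝ | Module.End.HasEigenvalue
          (DaubechiesCantor.cantorOperator n R M
            (DaubechiesCantor.canonicalAlphabet A)).toLinearMap (μ : ℂ)}
        (DaubechiesCantor.cantorEigenvalue 0 n R M
          (DaubechiesCantor.canonicalAlphabet A)) := by
  open DaubechiesCantor in
  have hsub : A ⊆ Finset.range M := hAM.1
  have hM : 0 < M := by
    obtain ⟨a, ha⟩ := hA
    exact (Nat.zero_le a).trans_lt (Finset.mem_range.1 (hsub ha))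
  -- This lets the comparison of eigenvalues be applied to the canonical alphabet itself.
  have hcc : canonicalAlphabet (canonicalAlphabet A) = canonicalAlphabet A := by
    rw [canonicalAlphabet, canonicalAlphabet, Finset.card_range]
  have h0 := cantorEigenvalue_zero_nonneg n R M (canonicalAlphabet A)
  have hle : ∀ k, cantorEigenvalue k n R M (canonicalAlphabet A) ≤
      cantorEigenvalue 0 n R M (canonicalAlphabet A) := fun k => by
    simpa only [hcc] using cantorEigenvalue_le k n hR hM (canonicalAlphabet_subset hsub)
  have hnorm := norm_cantorOperator_le n R M (canonicalAlphabet A) h0 hle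
  have hinner := inner_cantorOperator_gaussianL2 n R M (canonicalAlphabet A)
  have heig := apply_eq_smul_of_norm_le hnorm norm_gaussianL2 hinner
  have hvec : Module.End.HasEigenvector (cantorOperator n R M (canonicalAlphabet A)).toLinearMap
      ((cantorEigenvalue 0 n R M (canonicalAlphabet A) : ℝ) : ℂ) gaussianL2 := by
    refine Module.End.hasEigenvector_iff.2 ⟨Module.End.mem_eigenspace_iff.2 heig, ?_⟩
    rw [← norm_ne_zero_iff, norm_gaussianL2]
    exact one_ne_zero
  refine ⟨?_, le_antisymm hnorm ?_, hvec, Module.End.hasEigenvalue_of_hasEigenvector hvec, ?_⟩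
  -- The comparison gives the bound with constant 1; nonnegativity of λ_0 then gives the stated
  -- factor 2.
  · refine (norm_cantorOperator_le n R M A h0 fun k => cantorEigenvalue_le k n hR hM hsub).trans ?_
    linarith
  · have h := (cantorOperator n R M (canonicalAlphabet A)).le_opNorm gaussianL2
    rwa [heig, norm_smul, norm_gaussianL2, mul_one, mul_one, Complex.norm_real,
      Real.norm_of_nonneg h0] at h
  -- Every eigenvalue is at most the operator norm in absolute value.
  · intro μ hμ
    obtain ⟨v, hv⟩ := Module.End.HasEigenvalue.exists_hasEigenvector hμ
    have hv0 : 0 < ‖v‖ := norm_pos_iff.2 hv.2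
    have hap : cantorOperator n R M (canonicalAlphabet A) v = (μ : ℂ) • v := hv.apply_eq_smul
    have h := (cantorOperator n R M (canonicalAlphabet A)).le_of_opNorm_le hnorm v
    rw [hap, norm_smul, Complex.norm_real, Real.norm_eq_abs] at h
    exact (le_abs_self μ).trans (le_of_mul_le_mul_right h hv0)
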